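/- **Theorem (lower bound on wasted work).** Consider a randomized incremental algorithm with $n$ tasks. A uniformly random permutation of the tasks gives them labels $1,\dots,n$; a lower label means a higher priority. For labels $i<j$ the task with label $j$ may *depend* on the task with label $i$, which is then called an ancestor of it. The tasks are run with a MultiQueue with $k\ge 2$ queues: each task is initially inserted into a queue chosen independently and uniformly at random. At every step two queues are selected independently and uniformly at random (with replacement), and the scheduler returns the task of smallest label among the tops of the selected nonempty queues. If all ancestors of the returned task have been processed, the task is deleted from its queue and processed; otherwise it stays in its queue, and the step is called an *extra step*. (Selections in which both queues are empty return no task and are not counted.) The following two dependency structures are considered. 1. *Comparison sorting.* The tasks are $n$ distinct keys of a linearly ordered set. A task depends on all its proper ancestors in the binary search tree obtained by inserting the keys in the order of their labels. 2. *Delaunay triangulation.* The tasks are $n$ distinct points of the Euclidean plane, in the interior of a sufficiently large bounding triangle $T$; that is, no vertex of $T$ lies in a closed disk that has two input points as the ends of a diameter. No four distinct points among the input points and the vertices of $T$ are concyclic. A point *encroaches* on a triangle if it lies strictly inside its circumcircle. For $i<j$ the point $v$ with label $j$ depends on the point $u$ with label $i$ if the encroaching regions of $u$ and $v$ in the Delaunay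 triangulation of the vertices of $T$ and the points with labels $1,\dots,i-1$ (the mesh right before $u$ is added) overlap by at least an edge, i.e. some edge belongs both to a triangle on which $u$ encroaches and to a triangle on which $v$ encroaches. In both cases, for every $n\ge1$, every $k\ge2$ and every such input, the expected number of extra steps (over the random permutation, the random insertions and the random selections) is at least $\tfrac18\ln n$. In particular it is $\Omega(\log n)$, uniformly in $k$ and in the input. -/

import Mathlib

open MeasureTheory
open scoped ENNReal

/-! ### The generic relaxed framework driven by a MultiQueue

Tasks are identified with their labels in `Fin n`; a lower label is a higher priority.
`queue i` is the sequential priority queue in which the task with label `i` is stored, and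
`dep i j`, used for `i < j`, says that the task with label `j` depends on the one with label `i`.
The set `U` is the set of labels of the tasks not yet processed, i.e. still in the scheduler. -/

noncomputable section

namespace MultiQueue

variable {n k : ℕ}

/-- The label on top of queue `a`, or `⊤` if this queue is empty. -/
def top (queue : Fin n → Fin k) (U : Finset (Fin n)) (a : Fin k) : WithTop (Fin n) :=
  (U.filter (fun j => queue j = a)).min

/-- The label returned when the two queues `c.1`, `c.2` are selected: the better of their two
tops. It is `⊤` (no task is returned) only if both selected queues are empty. -/
def getMin (queue : Fin n → Fin k) (U : Finset (Fin n)) (c : Fin k × Fin k) :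
    WithTop (Fin n) :=
  min (top queue U c.1) (top queue U c.2)

/-- The task with label `j` has an ancestor (a task of smaller label on which it depends)
that is not yet processed. -/
def Blocked (dep : Fin n → Fin n → Prop) (U : Finset (Fin n)) (j : Fin n) : Prop :=
  ∃ i ∈ U, i < j ∧ dep i j

open Classical in
/-- One step: the returned task is deleted and processed, unless it is blocked; a blocked task
stays in its queue. -/
def step (dep : Fin n → Fin n → Prop) (queue : Fin n → Fin k) (U : Finset (Fin n))
    (c : Fin k × Fin k) : Finset (Fin n) :=
  U.filter (fun j => ¬ (getMin queue U c = (j : WithTop (Fin n)) ∧ ¬ Blocked dep U j))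

/-- The set of unprocessed tasks before step `t`, when the selected queues are `s 0, s 1, …`. -/
def pending (dep : Fin n → Fin n → Prop) (queue : Fin n → Fin k) (s : ℕ → Fin k × Fin k) :
    ℕ → Finset (Fin n)
  | 0 => Finset.univ
  | t + 1 => step dep queue (pending dep queue s t) (s t)

/-- Step `t` is an extra step: a task is returned, but it cannot be processed. -/
def IsExtraStep (dep : Fin n → Fin n → Prop) (queue : Fin n → Fin k) (s : ℕ → Fin k × Fin k)
    (t : ℕ) : Prop :=
  ∃ j : Fin n, getMin queue (pending dep queue s t) (s t) = (j : WithTop (Fin n)) ∧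
    Blocked dep (pending dep queue s t) j

/-- The number of extra steps of a run. Every other step at which a task is returned processes
this task, so this is the number of returned tasks minus `n` when the run terminates. Selections
of two empty queues return nothing and are not counted. -/
def extraSteps (dep : Fin n → Fin n → Prop) (queue : Fin n → Fin k)
    (s : ℕ → Fin k × Fin k) : ℕ∞ :=
  {t : ℕ | IsExtraStep dep queue s t}.encard

/-- The law of the selected queues: at every step an independent uniformly random pair. -/
def selectionLaw (k : ℕ) [NeZero k] : Measure (ℕ → Fin k × Fin k) :=
  Measure.infinitePi (fun _ => (PMF.uniformOfFintype (Fin k × Fin k)).toMeasure)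

/-- The expected number of extra steps of a randomized incremental algorithm on `n` tasks run with
a MultiQueue of `k` queues. Task `π i` gets label `i`, for a uniformly random permutation `π`;
every task `u` is stored in an independent uniformly random queue `q u`; the selections are
independent of both. `dep π` is the dependency relation, on labels, for the labelling `π`. -/
def expectedExtraSteps (n k : ℕ) [NeZero k]
    (dep : Equiv.Perm (Fin n) → Fin n → Fin n → Prop) : ℝ≥0∞ :=
  (∑ π : Equiv.Perm (Fin n), ∑ q : Fin n → Fin k,
      ∫⁻ s, (extraSteps (dep π) (q ∘ π) s : ℝ≥0∞) ∂(selectionLaw k)) /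
    (Fintype.card (Equiv.Perm (Fin n)) * Fintype.card (Fin n → Fin k))

end MultiQueue

/-! ### Comparison sorting via insertion into a binary search tree -/

namespace BSTSort

variable {K : Type*} [LinearOrder K]

/-- Insertion of a key at a leaf of a binary search tree. -/
def insert (x : K) : BinaryTree K → BinaryTree K
  | .nil => .node x .nil .nil
  | .node y l r => if x < y then .node y (insert x l) r else .node y l (insert x r)

/-- The tree obtained by inserting the keys of a list one by one, from left to right. -/
def build (xs : List K) : BinaryTree K :=
  xs.foldl (fun T x => insert x T) .nil

/-- `x` is the key of a node of the tree. -/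
def Mem (x : K) : BinaryTree K → Prop
  | .nil => False
  | .node y l r => x = y ∨ Mem x l ∨ Mem x r

/-- `x` is the key of a proper ancestor of a node with key `y`. -/
def IsAncestor (x y : K) : BinaryTree K → Prop
  | .nil => False
  | .node z l r => (x = z ∧ (Mem y l ∨ Mem y r)) ∨ IsAncestor x y l ∨ IsAncestor x y r

/-- The dependencies: a task depends on its ancestors in the tree resulting from inserting all
keys in the order of their labels. -/
def dep {n : ℕ} (key : Fin n → K) (π : Equiv.Perm (Fin n)) (i j : Fin n) : Prop :=
  IsAncestor (key (π i)) (key (π j)) (build (List.ofFn (fun l => key (π l))))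

end BSTSort

/-! ### Incremental Delaunay triangulation inside a bounding triangle -/

namespace Delaunay

/-- The Euclidean plane. -/
abbrev Plane : Type := EuclideanSpace ℝ (Fin 2)

/-- `p` encroaches on `t`: it lies strictly inside the circumcircle of `t`. -/
def Encroaches (p : Plane) (t : Affine.Triangle ℝ Plane) : Prop :=
  p ∈ Metric.ball t.circumcenter t.circumradius

/-- The triangles of the Delaunay triangulation of `S`: those with vertices in `S` on which no
point of `S` encroaches. -/
def mesh (S : Set Plane) : Set (Affine.Triangle ℝ Plane) :=
  {t | Set.range t.points ⊆ S ∧ ∀ p ∈ S, ¬ Encroaches p t}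

/-- The encroaching region of `p` in the Delaunay triangulation of `S`. -/
def region (S : Set Plane) (p : Plane) : Set (Affine.Triangle ℝ Plane) :=
  {t ∈ mesh S | Encroaches p t}

/-- The encroaching regions of `p` and `p'` in the Delaunay triangulation of `S` overlap by at
least an edge: some edge `ab` belongs to a triangle of each of them. -/
def Overlap (S : Set Plane) (p p' : Plane) : Prop :=
  ∃ t ∈ region S p, ∃ t' ∈ region S p', ∃ a b : Plane, a ≠ b ∧
    a ∈ Set.range t.points ∧ b ∈ Set.range t.points ∧
    a ∈ Set.range t'.points ∧ b ∈ Set.range t'.points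

/-- The vertices of the mesh right before the point with label `i` is added. -/
def before {n : ℕ} (P : Fin n → Plane) (T : Affine.Triangle ℝ Plane)
    (π : Equiv.Perm (Fin n)) (i : Fin n) : Set Plane :=
  Set.range T.points ∪ {p | ∃ l < i, p = P (π l)}

/-- The dependencies (for `i < j`): right before the first of the two points is added, their
encroaching regions overlap by at least an edge. -/
def dep {n : ℕ} (P : Fin n → Plane) (T : Affine.Triangle ℝ Plane)
    (π : Equiv.Perm (Fin n)) (i j : Fin n) : Prop :=
  Overlap (before P T π i) (P (π i)) (P (π j))

/-- `T` is a sufficiently large bounding triangle of the input points: they lie in its interior,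
and no vertex of `T` lies in a disk that has two input points as ends of a diameter (which holds,
for example, as soon as `T` contains the disk of radius `3 * r` around some point `x` such that
all input points are within distance `r` of `x`, where `0 < r`). -/
def IsBounding {n : ℕ} (P : Fin n → Plane) (T : Affine.Triangle ℝ Plane) : Prop :=
  (∀ u, P u ∈ T.interior) ∧
    ∀ u v m, T.points m ∉ Metric.closedBall (midpoint ℝ (P u) (P v)) (dist (P u) (P v) / 2)

/-- No four distinct points of `V` lie on a common circle, so that the Delaunay triangulations
of subsets of `V` are unique. -/
def NoFourConcyclic (V : Set Plane) : Prop :=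
  ∀ W ⊆ V, W.encard = 4 → ¬ EuclideanGeometry.Cospherical W

end Delaunay

end

/-! ### Runs of a MultiQueue -/

noncomputable section

namespace MultiQueue

variable {n k : ℕ}

/-! Only pairs of consecutive labels `i`, `i + 1` are counted. If `i + 1` depends on `i` and is
returned before either has ever been returned, that step is extra, and different `i` give different
steps. So it suffices to bound two probabilities and use linearity of expectation.

Inversion: for every fixed labelling, `i + 1` is returned before `i` with probability at least 1/8.
Exchange the queues of the two labels: since they are consecutive, the run is unchanged until one of
them is returned. At that moment a count of selections shows that `i` comes first under one
assignment at most 3 times as often as `i + 1` does under the other (`card_returning_le`,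
`one_le_inversion_add`). Averaging over assignments gives 1/4 when the queues differ, which happens
with probability at least 1/2 (`card_le_sum_inversion`).

Dependence: with labels starting at 0, `i + 1` depends on `i` with probability at least 1/(i+1).
Among the `i + 1` tasks with labels up to `i`, one makes the dependence hold when it is given label
`i` (`factorial_le_card_dep`). For sorting it is a key adjacent to the key labelled `i + 1`; for
Delaunay triangulation it is the point nearest to the point labelled `i + 1`.

Summing (1/8)·1/(i+1) gives a harmonic sum that dominates the logarithm. -/

theorem getMin_eq_min_filter (queue : Fin n → Fin k) (U : Finset (Fin n)) (c : Fin k × Fin k) :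
    getMin queue U c = (U.filter (fun j => queue j = c.1 ∨ queue j = c.2)).min := by
  rw [Finset.filter_or, Finset.min_union]
  rfl

theorem getMin_eq_coe_iff {queue : Fin n → Fin k} {U : Finset (Fin n)} {c : Fin k × Fin k}
    {j : Fin n} :
    getMin queue U c = (j : WithTop (Fin n)) ↔ j ∈ U ∧ (queue j = c.1 ∨ queue j = c.2) ∧
      ∀ i ∈ U, (queue i = c.1 ∨ queue i = c.2) → j ≤ i := by
  rw [getMin_eq_min_filter]
  constructor
  · intro h
    have hj := Finset.mem_filter.1 (Finset.mem_of_min h)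
    exact ⟨hj.1, hj.2, fun i hi hq =>
      Finset.min_le_of_eq (Finset.mem_filter.2 ⟨hi, hq⟩) h⟩
  · rintro ⟨hj, hq, hmin⟩
    refine le_antisymm (Finset.min_le (Finset.mem_filter.2 ⟨hj, hq⟩)) (Finset.le_min ?_)
    intro i hi
    rw [Finset.mem_filter] at hi
    exact WithTop.coe_le_coe.2 (hmin i hi.1 hi.2)

theorem getMin_eq_top_iff {queue : Fin n → Fin k} {U : Finset (Fin n)} {c : Fin k × Fin k} :
    getMin queue U c = ⊤ ↔ ∀ i ∈ U, ¬ (queue i = c.1 ∨ queue i = c.2) := by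
  rw [getMin_eq_min_filter, Finset.min_eq_top, Finset.filter_eq_empty_iff]

theorem mem_step_iff {dep : Fin n → Fin n → Prop} {queue : Fin n → Fin k}
    {U : Finset (Fin n)} {c : Fin k × Fin k} {j : Fin n} :
    j ∈ step dep queue U c ↔ j ∈ U ∧ ¬ (getMin queue U c = j ∧ ¬ Blocked dep U j) := by
  classical
  exact Finset.mem_filter

theorem step_subset (dep : Fin n → Fin n → Prop) (queue : Fin n → Fin k) (U : Finset (Fin n))
    (c : Fin k × Fin k) : step dep queue U c ⊆ U :=
  fun _ hj => (mem_step_iff.1 hj).1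

theorem mem_step_of_getMin_ne {dep : Fin n → Fin n → Prop} {queue : Fin n → Fin k}
    {U : Finset (Fin n)} {c : Fin k × Fin k} {j : Fin n} (hj : j ∈ U)
    (h : getMin queue U c ≠ j) : j ∈ step dep queue U c :=
  mem_step_iff.2 ⟨hj, fun h' => h h'.1⟩

theorem pending_antitone (dep : Fin n → Fin n → Prop) (queue : Fin n → Fin k)
    (s : ℕ → Fin k × Fin k) : Antitone (pending dep queue s) :=
  antitone_nat_of_succ_le fun _ => step_subset _ _ _ _

theorem pending_congr (dep : Fin n → Fin n → Prop) (queue : Fin n → Fin k)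
    {s s' : ℕ → Fin k × Fin k} {t : ℕ} (h : ∀ r < t, s r = s' r) :
    pending dep queue s t = pending dep queue s' t := by
  induction t with
  | zero => rfl
  | succ t ih =>
    simp only [pending]
    rw [ih fun r hr => h r (hr.trans t.lt_succ_self), h t t.lt_succ_self]

/-- If every queue is infinitely often selected twice at the same step, then all tasks are
eventually processed. -/
theorem exists_pending_eq_empty (dep : Fin n → Fin n → Prop) (queue : Fin n → Fin k)
    {s : ℕ → Fin k × Fin k} (hs : ∀ c N, ∃ t, N ≤ t ∧ s t = c) :
    ∃ t, pending dep queue s t = ∅ := by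
  -- A decreasing chain of finite sets stabilises. Its limit is empty, since the smallest pending
  -- label is never blocked and is returned once its queue is selected twice in one step.
  obtain ⟨N, hN⟩ := WellFoundedGT.monotone_chain_condition
    (⟨fun t => OrderDual.toDual (pending dep queue s t), pending_antitone dep queue s⟩ :
      ℕ →o (Finset (Fin n))ᵒᵈ)
  refine ⟨N, Finset.not_nonempty_iff_eq_empty.1 fun hne => ?_⟩
  set U := pending dep queue s N with hU
  obtain ⟨t, htN, ht⟩ := hs (queue (U.min' hne), queue (U.min' hne)) N
  have h1 : pending dep queue s t = U := (hN t htN).symm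
  have h2 : pending dep queue s (t + 1) = U := (hN (t + 1) (htN.trans t.le_succ)).symm
  have hmem := U.min'_mem hne
  have hstep : step dep queue U (s t) = U := by rw [← h1]; exact h2.trans h1.symm
  refine (mem_step_iff.1 (hstep.symm ▸ hmem : U.min' hne ∈ step dep queue U (s t))).2 ⟨getMin_eq_coe_iff.2 ⟨U.min'_mem hne, ?_, ?_⟩, ?_⟩
  · simp [ht]
  · exact fun i hi _ => U.min'_le i hi
  · rintro ⟨i, hi, hlt, -⟩
    exact absurd (U.min'_le i hi) (not_le.2 hlt)

/-- Neither `a` nor `b` is returned before step `t`. -/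
def NotReturned (dep : Fin n → Fin n → Prop) (queue : Fin n → Fin k) (a b : Fin n)
    (s : ℕ → Fin k × Fin k) (t : ℕ) : Prop :=
  ∀ r < t, getMin queue (pending dep queue s r) (s r) ≠ a ∧
    getMin queue (pending dep queue s r) (s r) ≠ b

theorem NotReturned.mem_pending {dep : Fin n → Fin n → Prop} {queue : Fin n → Fin k} {a b : Fin n}
    {s : ℕ → Fin k × Fin k} {t : ℕ} (h : NotReturned dep queue a b s t) :
    a ∈ pending dep queue s t ∧ b ∈ pending dep queue s t := by
  induction t with
  | zero => simp [pending]
  | succ t ih =>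
    have := ih fun r hr => h r (hr.trans t.lt_succ_self)
    exact ⟨mem_step_of_getMin_ne this.1 (h t t.lt_succ_self).1,
      mem_step_of_getMin_ne this.2 (h t t.lt_succ_self).2⟩

theorem notReturned_congr (dep : Fin n → Fin n → Prop) (queue : Fin n → Fin k) (a b : Fin n)
    {s s' : ℕ → Fin k × Fin k} {t : ℕ} (h : ∀ r < t, s r = s' r)
    (hs : NotReturned dep queue a b s t) : NotReturned dep queue a b s' t := by
  intro r hr
  rw [← pending_congr dep queue (fun r' hr' => h r' (hr'.trans hr)), ← h r hr]
  exact hs r hr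

/-! ### Swapping the queues of two consecutive labels -/

theorem le_swap_iff {a b i j : Fin n} (hab : (b : ℕ) = a + 1) (ha : j ≠ a) (hb : j ≠ b) :
    j ≤ Equiv.swap a b i ↔ j ≤ i := by
  have ha' : (j : ℕ) ≠ a := fun h => ha (Fin.ext h)
  have hb' : (j : ℕ) ≠ b := fun h => hb (Fin.ext h)
  rw [Equiv.swap_apply_def]
  split_ifs with h1 h2
  · subst h1; rw [Fin.le_def, Fin.le_def]; omega
  · subst h2; rw [Fin.le_def, Fin.le_def]; omega
  · rfl

theorem swap_mem {a b i : Fin n} {U : Finset (Fin n)} (ha : a ∈ U) (hb : b ∈ U) (hi : i ∈ U) :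
    Equiv.swap a b i ∈ U := by
  rw [Equiv.swap_apply_def]
  split_ifs <;> assumption

/-- The exchange alters only the positions of `a` and `b`, and no third label lies between them, so
any other label compares alike with both. -/
theorem getMin_comp_swap {queue : Fin n → Fin k} {a b : Fin n} (hab : (b : ℕ) = a + 1)
    {U : Finset (Fin n)} (ha : a ∈ U) (hb : b ∈ U) {c : Fin k × Fin k}
    (hca : getMin queue U c ≠ a) (hcb : getMin queue U c ≠ b) :
    getMin (queue ∘ Equiv.swap a b) U c = getMin queue U c := by
  cases h : getMin queue U c with
  | top =>
    rw [getMin_eq_top_iff] at h ⊢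
    exact fun i hi => h _ (swap_mem ha hb hi)
  | coe j =>
    have hja : j ≠ a := fun e => hca (by rw [h, e])
    have hjb : j ≠ b := fun e => hcb (by rw [h, e])
    rw [getMin_eq_coe_iff] at h ⊢
    refine ⟨h.1, ?_, fun i hi hq => ?_⟩
    · simpa [Equiv.swap_apply_of_ne_of_ne hja hjb] using h.2.1
    · exact (le_swap_iff hab hja hjb).1 (h.2.2 _ (swap_mem ha hb hi) hq)

theorem step_comp_swap (dep : Fin n → Fin n → Prop) {queue : Fin n → Fin k} {a b : Fin n}
    (hab : (b : ℕ) = a + 1) {U : Finset (Fin n)} (ha : a ∈ U) (hb : b ∈ U) {c : Fin k × Fin k}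
    (hca : getMin queue U c ≠ a) (hcb : getMin queue U c ≠ b) :
    step dep (queue ∘ Equiv.swap a b) U c = step dep queue U c := by
  ext j
  simp only [mem_step_iff, getMin_comp_swap hab ha hb hca hcb]

/-- The coupling: with the same selections, the runs for the two queue assignments agree until `a`
or `b` is returned. -/
theorem NotReturned.comp_swap {dep : Fin n → Fin n → Prop} {queue : Fin n → Fin k} {a b : Fin n}
    (hab : (b : ℕ) = a + 1) {s : ℕ → Fin k × Fin k} {t : ℕ} (h : NotReturned dep queue a b s t) :
    NotReturned dep (queue ∘ Equiv.swap a b) a b s t ∧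
      pending dep (queue ∘ Equiv.swap a b) s t = pending dep queue s t := by
  induction t with
  | zero => exact ⟨fun r hr => absurd hr r.not_lt_zero, rfl⟩
  | succ t ih =>
    have ht : NotReturned dep queue a b s t := fun r hr => h r (hr.trans t.lt_succ_self)
    obtain ⟨h1, h2⟩ := ih ht
    obtain ⟨ha, hb⟩ := ht.mem_pending
    obtain ⟨hca, hcb⟩ := h t t.lt_succ_self
    constructor
    · intro r hr
      rcases Nat.lt_succ_iff_lt_or_eq.1 hr with hr | rfl
      · exact h1 r hr
      · rw [h2, getMin_comp_swap hab ha hb hca hcb]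
        exact ⟨hca, hcb⟩
    · simp only [pending]
      rw [h2, step_comp_swap dep hab ha hb hca hcb]

/-- The selections at which the task with label `j` is returned. -/
def returning (queue : Fin n → Fin k) (U : Finset (Fin n)) (j : Fin n) :
    Finset (Fin k × Fin k) :=
  Finset.univ.filter fun c => getMin queue U c = j

theorem getMin_comp_swap_eq_coe {queue : Fin n → Fin k} {a b : Fin n} (hab : (b : ℕ) = a + 1)
    {U : Finset (Fin n)} (hb : b ∈ U) {c : Fin k × Fin k}
    (hc : getMin queue U c = a) (hq : ¬ (queue b = c.1 ∨ queue b = c.2)) :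
    getMin (queue ∘ Equiv.swap a b) U c = b := by
  rw [getMin_eq_coe_iff] at hc ⊢
  refine ⟨hb, by simpa using hc.2.1, fun i hi hqi => ?_⟩
  rcases eq_or_ne i a with rfl | hia
  · exact absurd (by simpa using hqi) hq
  rcases eq_or_ne i b with rfl | hib
  · rfl
  have := hc.2.2 i hi (by simpa [Equiv.swap_apply_of_ne_of_ne hia hib] using hqi)
  have hia' : (i : ℕ) ≠ a := fun h => hia (Fin.ext h)
  rw [Fin.le_def] at this ⊢
  omega

/-- A selection returning `a` returns `b` after the exchange, unless it also hits the queue of `b`.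
Only two ordered pairs can be lost this way. If `a` is the top of its queue, selecting that queue
twice is not lost, so the count x on the right is positive and x + 2 ≤ 3x. -/
theorem card_returning_le {queue : Fin n → Fin k} {a b : Fin n} (hab : (b : ℕ) = a + 1)
    {U : Finset (Fin n)} (hb : b ∈ U) (hq : queue a ≠ queue b) :
    (returning queue U a).card ≤ 3 * (returning (queue ∘ Equiv.swap a b) U b).card := by
  rcases (returning queue U a).eq_empty_or_nonempty with h0 | ⟨c, hc⟩
  · simp [h0]
  have hc := getMin_eq_coe_iff.1 (Finset.mem_filter.1 hc).2
  have hpos : 0 < (returning (queue ∘ Equiv.swap a b) U b).card := by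
    refine Finset.card_pos.2 ⟨(queue a, queue a), Finset.mem_filter.2 ⟨Finset.mem_univ _, ?_⟩⟩
    refine getMin_comp_swap_eq_coe hab hb
      (getMin_eq_coe_iff.2 ⟨hc.1, by simp, fun i hi hqi => hc.2.2 i hi ?_⟩) (by simpa using hq.symm)
    rw [or_self] at hqi
    rw [hqi]
    exact hc.2.1
  have hsub : returning queue U a ⊆ returning (queue ∘ Equiv.swap a b) U b ∪
      {(queue a, queue b), (queue b, queue a)} := by
    intro d hd
    have hd := (Finset.mem_filter.1 hd).2
    by_cases hqd : queue b = d.1 ∨ queue b = d.2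
    · refine Finset.mem_union_right _ ?_
      have h2 := (getMin_eq_coe_iff.1 hd).2.1
      obtain ⟨d1, d2⟩ := d
      simp only [Finset.mem_insert, Finset.mem_singleton, Prod.mk.injEq]
      grind
    · exact Finset.mem_union_left _
        (Finset.mem_filter.2 ⟨Finset.mem_univ _, getMin_comp_swap_eq_coe hab hb hd hqd⟩)
  have := (Finset.card_le_card hsub).trans (Finset.card_union_le _ _)
  have h2 : ({(queue a, queue b), (queue b, queue a)} : Finset (Fin k × Fin k)).card ≤ 2 :=
    Finset.card_le_two
  omega

/-! ### Random selections -/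

instance (k : ℕ) [NeZero k] : IsProbabilityMeasure (selectionLaw k) := by
  unfold selectionLaw; infer_instance

theorem uniformOfFintype_toMeasure_finset [NeZero k] (C : Finset (Fin k × Fin k)) :
    (PMF.uniformOfFintype (Fin k × Fin k)).toMeasure C =
      (C.card : ℝ≥0∞) / Fintype.card (Fin k × Fin k) := by
  rw [PMF.toMeasure_uniformOfFintype_apply _ C.measurableSet]
  simp

/-- A set of selections that is determined by the first `t` steps. -/
def DependsBefore (t : ℕ) (D : Set (ℕ → Fin k × Fin k)) : Prop :=
  ∀ s s', (∀ r < t, s r = s' r) → s ∈ D → s' ∈ D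

theorem DependsBefore.eq_preimage {t : ℕ} {D : Set (ℕ → Fin k × Fin k)} (hD : DependsBefore t D) :
    D = (fun s (r : Finset.range t) => s r) ⁻¹'
      ((fun s (r : Finset.range t) => s r) '' D) := by
  refine Set.Subset.antisymm (Set.subset_preimage_image _ _) ?_
  rintro s ⟨s', hs', h⟩
  exact hD s' s (fun r hr => congrFun h ⟨r, Finset.mem_range.2 hr⟩) hs'

theorem DependsBefore.measurableSet {t : ℕ} {D : Set (ℕ → Fin k × Fin k)}
    (hD : DependsBefore t D) : MeasurableSet D := by
  rw [hD.eq_preimage]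
  exact (by fun_prop : Measurable fun (s : ℕ → Fin k × Fin k) (r : Finset.range t) => s r)
    (Set.to_countable _).measurableSet

/-- The selection at step `t` is independent of the earlier ones. -/
theorem selectionLaw_inter [NeZero k] {t : ℕ} {D : Set (ℕ → Fin k × Fin k)}
    (hD : DependsBefore t D) (C : Finset (Fin k × Fin k)) :
    selectionLaw k (D ∩ {s | s t ∈ C}) =
      selectionLaw k D * (C.card / Fintype.card (Fin k × Fin k)) := by
  have hind := ProbabilityTheory.iIndepFun.indepFun_finset (Finset.range t) {t} (by simp)
    (ProbabilityTheory.iIndepFun_infinitePi (P := fun _ : ℕ =>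
      (PMF.uniformOfFintype (Fin k × Fin k)).toMeasure) (X := fun _ c => c)
      (fun _ => measurable_id)) (fun i => measurable_pi_apply i)
  have hmap : selectionLaw k {s | s t ∈ C} = C.card / Fintype.card (Fin k × Fin k) := by
    rw [← uniformOfFintype_toMeasure_finset]
    exact (measurePreserving_eval_infinitePi (fun _ : ℕ =>
      (PMF.uniformOfFintype (Fin k × Fin k)).toMeasure) t).measure_preimage
      C.measurableSet.nullMeasurableSet
  have h := hind.measure_inter_preimage_eq_mul ((fun s (r : Finset.range t) => s r) '' D)
    ((fun g : (r : ({t} : Finset ℕ)) → Fin k × Fin k => g ⟨t, by simp⟩) ⁻¹' C)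
    (Set.to_countable _).measurableSet (Set.to_countable _).measurableSet
  rw [← hmap]
  have hD' := hD.eq_preimage
  simp only at h
  rw [← hD'] at h
  exact h

theorem ae_frequently_selected [NeZero k] :
    ∀ᵐ s ∂selectionLaw k, ∀ c N, ∃ t, N ≤ t ∧ s t = c := by
  rw [ae_all_iff]; intro c
  rw [ae_all_iff]; intro N
  set ν := (PMF.uniformOfFintype (Fin k × Fin k)).toMeasure with hν
  have hlt : ν {c}ᶜ < 1 := by
    rw [prob_compl_eq_one_sub (MeasurableSet.singleton c)]
    refine ENNReal.sub_lt_self (by simp) (by simp) ?_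
    have := uniformOfFintype_toMeasure_finset ({c} : Finset (Fin k × Fin k))
    rw [Finset.coe_singleton] at this
    rw [hν, this]
    simp [NeZero.ne k, ENNReal.mul_eq_top]
  -- Avoiding `c` from step `N` on implies avoiding it during any `m` consecutive steps, which has
  -- geometrically small probability.
  have hle : ∀ m : ℕ, selectionLaw k {s | ¬ ∃ t, N ≤ t ∧ s t = c} ≤ ν {c}ᶜ ^ m := by
    intro m
    have h := Measure.infinitePi_pi (fun _ : ℕ => ν) (s := Finset.Ico N (N + m))
      (t := fun _ => {c}ᶜ) (fun _ _ => (MeasurableSet.singleton c).compl)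
    rw [Finset.prod_const, Nat.card_Ico, Nat.add_sub_cancel_left] at h
    rw [← h]
    refine measure_mono fun s hs t ht hst => hs ⟨t, ?_, hst⟩
    simp only [Finset.coe_Ico, Set.mem_Ico] at ht
    exact ht.1
  exact le_antisymm (ge_of_tendsto' (ENNReal.tendsto_pow_atTop_nhds_zero_of_lt_one hlt) hle)
    zero_le

end MultiQueue

end

/-! ### The probability of an inversion -/

noncomputable section

namespace MultiQueue

variable {n k : ℕ}

/-- The runs with neither `a` nor `b` returned before step `t` and with the set `V` of pending
tasks at step `t`. -/
def stage (dep : Fin n → Fin n → Prop) (queue : Fin n → Fin k) (a b : Fin n) (t : ℕ)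
    (V : Finset (Fin n)) : Set (ℕ → Fin k × Fin k) :=
  {s | NotReturned dep queue a b s t ∧ pending dep queue s t = V}

/-- The runs with neither `a` nor `b` returned before step `t`, at which `j` is returned. -/
def firstReturn (dep : Fin n → Fin n → Prop) (queue : Fin n → Fin k) (a b j : Fin n) (t : ℕ) :
    Set (ℕ → Fin k × Fin k) :=
  {s | NotReturned dep queue a b s t ∧ getMin queue (pending dep queue s t) (s t) = j}

/-- The runs in which `b` is returned while neither `a` nor `b` has been returned before. -/
def inversion (dep : Fin n → Fin n → Prop) (queue : Fin n → Fin k) (a b : Fin n) :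
    Set (ℕ → Fin k × Fin k) :=
  ⋃ t, firstReturn dep queue a b b t

theorem dependsBefore_stage (dep : Fin n → Fin n → Prop) (queue : Fin n → Fin k) (a b : Fin n)
    (t : ℕ) (V : Finset (Fin n)) : DependsBefore t (stage dep queue a b t V) :=
  fun _ _ h hs => ⟨notReturned_congr dep queue a b h hs.1, (pending_congr dep queue h).symm ▸ hs.2⟩

theorem dependsBefore_firstReturn (dep : Fin n → Fin n → Prop) (queue : Fin n → Fin k)
    (a b j : Fin n) (t : ℕ) : DependsBefore (t + 1) (firstReturn dep queue a b j t) := by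
  intro s s' h hs
  have h' : ∀ r < t, s r = s' r := fun r hr => h r (hr.trans t.lt_succ_self)
  refine ⟨notReturned_congr dep queue a b h' hs.1, ?_⟩
  rw [← pending_congr dep queue h', ← h t t.lt_succ_self]
  exact hs.2

theorem stage_comp_swap (dep : Fin n → Fin n → Prop) (queue : Fin n → Fin k) {a b : Fin n}
    (hab : (b : ℕ) = a + 1) (t : ℕ) (V : Finset (Fin n)) :
    stage dep (queue ∘ Equiv.swap a b) a b t V = stage dep queue a b t V := by
  have key : ∀ q : Fin n → Fin k, stage dep q a b t V ⊆ stage dep (q ∘ Equiv.swap a b) a b t V :=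
    fun q s hs => ⟨(hs.1.comp_swap hab).1, (hs.1.comp_swap hab).2.trans hs.2⟩
  refine Set.Subset.antisymm ?_ (key queue)
  have h := key (queue ∘ Equiv.swap a b)
  have e : (queue ∘ Equiv.swap a b) ∘ Equiv.swap a b = queue := by
    ext i; simp
  rwa [e] at h

theorem selectionLaw_firstReturn [NeZero k] (dep : Fin n → Fin n → Prop) (queue : Fin n → Fin k)
    (a b j : Fin n) (t : ℕ) :
    selectionLaw k (firstReturn dep queue a b j t) = ∑ V : Finset (Fin n),
      selectionLaw k (stage dep queue a b t V) *
        ((returning queue V j).card / Fintype.card (Fin k × Fin k)) := by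
  have h : firstReturn dep queue a b j t = ⋃ V ∈ (Finset.univ : Finset (Finset (Fin n))),
      stage dep queue a b t V ∩ {s | s t ∈ returning queue V j} := by
    ext s
    simp [firstReturn, stage, returning, and_assoc]
  rw [h, measure_biUnion_finset]
  · exact Finset.sum_congr rfl fun V _ =>
      selectionLaw_inter (dependsBefore_stage dep queue a b t V) _
  · intro V _ W _ hVW
    exact Set.disjoint_left.2 fun s hV hW => hVW (hV.1.2.symm.trans hW.1.2)
  · intro V _
    exact (dependsBefore_stage dep queue a b t V).measurableSet.inter
      (measurable_pi_apply t (returning queue V j).measurableSet)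

/-- Conditioned on the pending set at step `t`, the bound is the count of selections; the
conditioning events are the same for both assignments. -/
theorem selectionLaw_firstReturn_le [NeZero k] (dep : Fin n → Fin n → Prop)
    {queue : Fin n → Fin k} {a b : Fin n} (hab : (b : ℕ) = a + 1) (hq : queue a ≠ queue b)
    (t : ℕ) : selectionLaw k (firstReturn dep queue a b a t) ≤
      3 * selectionLaw k (firstReturn dep (queue ∘ Equiv.swap a b) a b b t) := by
  rw [selectionLaw_firstReturn, selectionLaw_firstReturn, Finset.mul_sum]
  refine Finset.sum_le_sum fun V _ => ?_
  rw [stage_comp_swap dep queue hab]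
  by_cases hb : b ∈ V
  · rw [mul_left_comm (3 : ℝ≥0∞), ← mul_div_assoc (3 : ℝ≥0∞)]
    gcongr
    exact_mod_cast card_returning_le hab hb hq
  · have h0 : stage dep queue a b t V = ∅ := by
      refine Set.eq_empty_of_forall_notMem fun s hs => hb ?_
      rw [← hs.2]
      exact hs.1.mem_pending.2
    simp [h0]

theorem measurableSet_inversion (dep : Fin n → Fin n → Prop) (queue : Fin n → Fin k)
    (a b : Fin n) : MeasurableSet (inversion dep queue a b) :=
  MeasurableSet.iUnion fun t => (dependsBefore_firstReturn dep queue a b b t).measurableSet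

theorem selectionLaw_inversion [NeZero k] (dep : Fin n → Fin n → Prop) (queue : Fin n → Fin k)
    (a b : Fin n) : selectionLaw k (inversion dep queue a b) =
      ∑' t, selectionLaw k (firstReturn dep queue a b b t) := by
  refine measure_iUnion ?_ fun t => (dependsBefore_firstReturn dep queue a b b t).measurableSet
  intro t t' htt'
  refine Set.disjoint_left.2 fun s h h' => ?_
  rcases lt_or_gt_of_ne htt' with hlt | hlt
  · exact (h'.1 t hlt).2 h.2
  · exact (h.1 t' hlt).2 h'.2

/-- Almost surely every task is eventually processed, so one of `a`, `b` is the first of the two to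
be returned. -/
theorem ae_exists_firstReturn [NeZero k] (dep : Fin n → Fin n → Prop) (queue : Fin n → Fin k)
    (a b : Fin n) : ∀ᵐ s ∂selectionLaw k, s ∈ (⋃ t, firstReturn dep queue a b a t) ∪
      inversion dep queue a b := by
  classical
  filter_upwards [ae_frequently_selected] with s hs
  obtain ⟨T, hT⟩ := exists_pending_eq_empty dep queue hs
  have hex : ∃ t, getMin queue (pending dep queue s t) (s t) = a ∨
      getMin queue (pending dep queue s t) (s t) = b := by
    by_contra! hcon
    have : NotReturned dep queue a b s T := fun r _ => hcon r
    simpa [hT] using this.mem_pending.1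
  have hnot : NotReturned dep queue a b s (Nat.find hex) := fun r hr =>
    not_or.1 (Nat.find_min hex hr)
  rcases Nat.find_spec hex with h | h
  · exact Or.inl (Set.mem_iUnion.2 ⟨_, hnot, h⟩)
  · exact Or.inr (Set.mem_iUnion.2 ⟨_, hnot, h⟩)

theorem one_le_inversion_add [NeZero k] (dep : Fin n → Fin n → Prop)
    {queue : Fin n → Fin k} {a b : Fin n} (hab : (b : ℕ) = a + 1) (hq : queue a ≠ queue b) :
    1 ≤ 3 * selectionLaw k (inversion dep (queue ∘ Equiv.swap a b) a b) +
      selectionLaw k (inversion dep queue a b) := by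
  have h1 : 1 ≤ selectionLaw k
      ((⋃ t, firstReturn dep queue a b a t) ∪ inversion dep queue a b) := by
    rw [← measure_univ (μ := selectionLaw k)]
    exact measure_mono_ae ((ae_exists_firstReturn dep queue a b).mono fun s hs _ => hs)
  refine h1.trans <| (measure_union_le _ _).trans ?_
  gcongr
  refine (measure_iUnion_le _).trans ?_
  rw [selectionLaw_inversion, ← ENNReal.tsum_mul_left]
  exact ENNReal.tsum_le_tsum fun t => selectionLaw_firstReturn_le dep hab hq t

/-! ### Averaging over the queue assignments -/

theorem card_le_two_mul_card_ne (hk : 2 ≤ k) {a b : Fin n} (hab : a ≠ b) :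
    Fintype.card (Fin n → Fin k) ≤
      2 * (Finset.univ.filter fun q : Fin n → Fin k => q a ≠ q b).card := by
  have : NeZero k := ⟨by omega⟩
  have : Nontrivial (Fin k) := Fin.nontrivial_iff_two_le.2 hk
  have h := Finset.card_filter_add_card_filter_not (s := (Finset.univ : Finset (Fin n → Fin k)))
    (fun q => q a ≠ q b)
  have hle : (Finset.univ.filter fun q : Fin n → Fin k => ¬ q a ≠ q b).card ≤
      (Finset.univ.filter fun q : Fin n → Fin k => q a ≠ q b).card := by
    -- Moving `b` cyclically to the next queue maps assignments with equal queues injectively to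
    -- assignments with different ones, as there are at least two queues.
    refine Finset.card_le_card_of_injOn (fun q => Function.update q b (q b + 1)) ?_ ?_
    · intro q hq
      have hq : q a = q b := by simpa using hq
      simp [Function.update_of_ne hab, hq, show k ≠ 1 by omega]
    · intro q _ q' _ h
      funext i
      have hi := congrFun h i
      by_cases hib : i = b
      · subst hib; simpa using hi
      · simpa [Function.update_of_ne hib] using hi
  rw [Finset.card_univ] at h
  omega

/-- The exchange permutes the assignments, so both terms of `one_le_inversion_add` are bounded by
the same sum, with total factor 3 + 1. The factor 2 for the assignments with different queues makes
8. -/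
theorem card_le_sum_inversion [NeZero k] (hk : 2 ≤ k) (dep : Fin n → Fin n → Prop) {a b : Fin n}
    (hab : (b : ℕ) = a + 1) : (Fintype.card (Fin n → Fin k) : ℝ≥0∞) ≤
      8 * ∑ q : Fin n → Fin k, selectionLaw k (inversion dep q a b) := by
  have hne : a ≠ b := fun h => by rw [h] at hab; omega
  have hsum : ∑ q : Fin n → Fin k, selectionLaw k (inversion dep (q ∘ Equiv.swap a b) a b) =
      ∑ q : Fin n → Fin k, selectionLaw k (inversion dep q a b) :=
    Fintype.sum_equiv ((Equiv.swap a b).arrowCongr (Equiv.refl _)) _ _ fun q => by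
      rw [show (Equiv.swap a b).arrowCongr (Equiv.refl _) q = q ∘ Equiv.swap a b by
        ext i; simp [Equiv.arrowCongr]]
  have h1 : ((Finset.univ.filter fun q : Fin n → Fin k => q a ≠ q b).card : ℝ≥0∞) ≤
      4 * ∑ q : Fin n → Fin k, selectionLaw k (inversion dep q a b) :=
    calc ((Finset.univ.filter fun q : Fin n → Fin k => q a ≠ q b).card : ℝ≥0∞)
        = ∑ q : Fin n → Fin k with q a ≠ q b, 1 := by simp
      _ ≤ ∑ q : Fin n → Fin k with q a ≠ q b,
            (3 * selectionLaw k (inversion dep (q ∘ Equiv.swap a b) a b) +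
              selectionLaw k (inversion dep q a b)) :=
          Finset.sum_le_sum fun q hq =>
            one_le_inversion_add dep hab (Finset.mem_filter.1 hq).2
      _ ≤ ∑ q : Fin n → Fin k,
            (3 * selectionLaw k (inversion dep (q ∘ Equiv.swap a b) a b) +
              selectionLaw k (inversion dep q a b)) :=
          Finset.sum_le_sum_of_subset (Finset.filter_subset _ _)
      _ = 4 * ∑ q : Fin n → Fin k, selectionLaw k (inversion dep q a b) := by
          rw [Finset.sum_add_distrib, ← Finset.mul_sum, hsum]
          ring
  calc (Fintype.card (Fin n → Fin k) : ℝ≥0∞)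
      ≤ 2 * ((Finset.univ.filter fun q : Fin n → Fin k => q a ≠ q b).card : ℝ≥0∞) := by
        exact_mod_cast card_le_two_mul_card_ne hk hne
    _ ≤ 2 * (4 * ∑ q : Fin n → Fin k, selectionLaw k (inversion dep q a b)) := by gcongr
    _ = _ := by ring

/-! ### Extra steps from consecutive dependent labels -/

variable {m : ℕ}

open Classical in
theorem card_le_extraSteps (dep : Fin (m + 1) → Fin (m + 1) → Prop) (queue : Fin (m + 1) → Fin k)
    (s : ℕ → Fin k × Fin k) :
    ((Finset.univ.filter fun i : Fin m => dep i.castSucc i.succ ∧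
      s ∈ inversion dep queue i.castSucc i.succ).card : ℕ∞) ≤ extraSteps dep queue s := by
  set J := Finset.univ.filter fun i : Fin m => dep i.castSucc i.succ ∧
      s ∈ inversion dep queue i.castSucc i.succ with hJ
  have hex : ∀ i ∈ J, ∃ t, s ∈ firstReturn dep queue i.castSucc i.succ i.succ t := fun i hi =>
    Set.mem_iUnion.1 (Finset.mem_filter.1 hi).2.2
  choose! t ht using hex
  rw [← Set.encard_coe_eq_coe_finsetCard]
  -- A step returns only one label, so it serves only one pair.
  have hinj : Set.InjOn t (J : Set (Fin m)) := by
    intro i hi j hj hij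
    have h1 := (ht i hi).2
    rw [hij, (ht j hj).2] at h1
    exact (Fin.succ_injective _ (WithTop.coe_injective h1)).symm
  rw [← hinj.encard_image]
  refine Set.encard_le_encard ?_
  rintro _ ⟨i, hi, rfl⟩
  exact ⟨i.succ, (ht i hi).2, i.castSucc, (ht i hi).1.mem_pending.1, Fin.castSucc_lt_succ,
    (Finset.mem_filter.1 hi).2.1⟩

open Classical in
theorem sum_inversion_le_lintegral [NeZero k] (dep : Fin (m + 1) → Fin (m + 1) → Prop)
    (queue : Fin (m + 1) → Fin k) :
    ∑ i : Fin m with dep i.castSucc i.succ,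
      selectionLaw k (inversion dep queue i.castSucc i.succ) ≤
      ∫⁻ s, (extraSteps dep queue s : ℝ≥0∞) ∂(selectionLaw k) := by
  calc ∑ i : Fin m with dep i.castSucc i.succ,
      selectionLaw k (inversion dep queue i.castSucc i.succ)
      = ∑ i : Fin m with dep i.castSucc i.succ, ∫⁻ s,
          (inversion dep queue i.castSucc i.succ).indicator 1 s ∂(selectionLaw k) :=
        Finset.sum_congr rfl fun i _ =>
          (lintegral_indicator_one (measurableSet_inversion dep queue _ _)).symm
    _ = ∫⁻ s, ∑ i : Fin m with dep i.castSucc i.succ,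
          (inversion dep queue i.castSucc i.succ).indicator 1 s ∂(selectionLaw k) :=
        (lintegral_finsetSum _ fun i _ =>
          measurable_one.indicator (measurableSet_inversion dep queue _ _)).symm
    _ ≤ _ := by
        refine lintegral_mono fun s => ?_
        have h := card_le_extraSteps dep queue s
        have h' := ENat.toENNReal_le.2 h
        refine le_trans (le_of_eq ?_) h'
        rw [← Finset.filter_filter]
        simp [Set.indicator_apply]

/-! ### Dependence of consecutive labels, and the harmonic sum -/

open Classical in
-- Given `l`, the swap can be undone, so sending a permutation to its swapped version together with
-- `l` is injective; `l` takes at most `i + 1` values.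
theorem factorial_le_card_dep (dep : Equiv.Perm (Fin (m + 1)) → Fin (m + 1) → Fin (m + 1) → Prop)
    (i : Fin m)
    (h : ∀ π, ∃ l ≤ i.castSucc, dep (Equiv.swap l i.castSucc |>.trans π) i.castSucc i.succ) :
    Fintype.card (Equiv.Perm (Fin (m + 1))) ≤
      (Finset.univ.filter fun π => dep π i.castSucc i.succ).card * (i + 1) := by
  choose l hl hdep using h
  have := Finset.card_le_card_of_injOn (s := (Finset.univ : Finset (Equiv.Perm (Fin (m + 1)))))
    (t := (Finset.univ.filter fun π => dep π i.castSucc i.succ) ×ˢ Finset.Iic i.castSucc)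
    (fun π => ((Equiv.swap (l π) i.castSucc).trans π, l π))
    (fun π _ => by simp [hdep π, hl π])
    (by
      intro π _ π' _ hπ
      simp only [Prod.mk.injEq] at hπ
      obtain ⟨h1, h2⟩ := hπ
      rw [h2] at h1
      ext x
      have := congrArg (fun e => e (Equiv.swap (l π') i.castSucc x)) h1
      simpa using congrArg Fin.val this)
  simpa using this

/-- If, for every label `i`, the tasks with labels up to `i` can be relabelled by one swap with
`i` such that the task with label `i + 1` depends on that with label `i`, then the expected
number of extra steps is at least `(log n) / 8`. -/
theorem log_le_expectedExtraSteps [NeZero k] (hk : 2 ≤ k)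
    (dep : Equiv.Perm (Fin (m + 1)) → Fin (m + 1) → Fin (m + 1) → Prop)
    (h : ∀ π, ∀ i : Fin m,
      ∃ l ≤ i.castSucc, dep (Equiv.swap l i.castSucc |>.trans π) i.castSucc i.succ) :
    ENNReal.ofReal (1 / 8 * Real.log (m + 1 : ℕ)) ≤ expectedExtraSteps (m + 1) k dep := by
  classical
  set N := Fintype.card (Equiv.Perm (Fin (m + 1))) with hN
  set Q := Fintype.card (Fin (m + 1) → Fin k) with hQ
  have hN0 : (N : ℝ≥0∞) ≠ 0 := by simp [hN, Fintype.card_ne_zero]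
  have hQ0 : (Q : ℝ≥0∞) ≠ 0 := by exact_mod_cast Fintype.card_ne_zero
  unfold expectedExtraSteps
  rw [ENNReal.le_div_iff_mul_le (Or.inl (mul_ne_zero hN0 hQ0))
    (Or.inl (ENNReal.mul_ne_top (ENNReal.natCast_ne_top _) (ENNReal.natCast_ne_top _)))]
  have hlog : ENNReal.ofReal (1 / 8 * Real.log (m + 1 : ℕ)) ≤
      ∑ i : Fin m, (8 : ℝ≥0∞)⁻¹ * ((i : ℕ) + 1 : ℝ≥0∞)⁻¹ := by
    rw [← Finset.mul_sum, ENNReal.ofReal_mul (by norm_num)]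
    have e8 : ENNReal.ofReal (1 / 8) = 8⁻¹ := by
      rw [one_div, ENNReal.ofReal_inv_of_pos (by norm_num)]
      norm_num
    rw [e8]
    gcongr
    refine (ENNReal.ofReal_le_ofReal (log_add_one_le_harmonic m)).trans (le_of_eq ?_)
    rw [harmonic, Rat.cast_sum, ENNReal.ofReal_sum_of_nonneg (fun i _ => by positivity),
      Finset.sum_range]
    refine Finset.sum_congr rfl fun i _ => ?_
    rw [Rat.cast_inv, ENNReal.ofReal_inv_of_pos (by positivity)]
    congr 1
    rw [Rat.cast_natCast, ENNReal.ofReal_natCast]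
    push_cast
    rfl
  refine (mul_le_mul_left hlog _).trans ?_
  rw [Finset.sum_mul]
  calc ∑ i : Fin m, (8 : ℝ≥0∞)⁻¹ * ((i : ℕ) + 1 : ℝ≥0∞)⁻¹ * (N * Q)
      ≤ ∑ i : Fin m, ∑ π : Equiv.Perm (Fin (m + 1)) with dep π i.castSucc i.succ,
          ∑ q : Fin (m + 1) → Fin k,
            selectionLaw k (inversion (dep π) q i.castSucc i.succ) := by
        refine Finset.sum_le_sum fun i _ => ?_
        have hc : (N : ℝ≥0∞) * ((i : ℕ) + 1 : ℝ≥0∞)⁻¹ ≤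
            ((Finset.univ.filter fun π => dep π i.castSucc i.succ).card : ℝ≥0∞) := by
          rw [← div_eq_mul_inv]
          refine ENNReal.div_le_of_le_mul ?_
          exact_mod_cast factorial_le_card_dep dep i fun π => h π i
        calc (8 : ℝ≥0∞)⁻¹ * ((i : ℕ) + 1 : ℝ≥0∞)⁻¹ * (N * Q)
            = (N * ((i : ℕ) + 1 : ℝ≥0∞)⁻¹) * (8⁻¹ * Q) := by ring
          _ ≤ ((Finset.univ.filter fun π => dep π i.castSucc i.succ).card : ℝ≥0∞) *
                (8⁻¹ * Q) := by gcongr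
          _ = ∑ π : Equiv.Perm (Fin (m + 1)) with dep π i.castSucc i.succ, 8⁻¹ * (Q : ℝ≥0∞) := by
              rw [Finset.sum_const, nsmul_eq_mul]
          _ ≤ _ := by
              refine Finset.sum_le_sum fun π _ => ?_
              rw [mul_comm, ← div_eq_mul_inv]
              refine ENNReal.div_le_of_le_mul' ?_
              exact card_le_sum_inversion hk (dep π) (by simp)
    _ = ∑ π : Equiv.Perm (Fin (m + 1)), ∑ q : Fin (m + 1) → Fin k,
          ∑ i : Fin m with dep π i.castSucc i.succ,
            selectionLaw k (inversion (dep π) q i.castSucc i.succ) := by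
        simp only [Finset.sum_filter]
        rw [Finset.sum_comm]
        refine Finset.sum_congr rfl fun π _ => ?_
        rw [Finset.sum_comm]
        refine Finset.sum_congr rfl fun i _ => ?_
        split_ifs <;> simp
    _ = ∑ π : Equiv.Perm (Fin (m + 1)), ∑ q : Fin (m + 1) → Fin k,
          ∑ i : Fin m with dep π i.castSucc i.succ,
            selectionLaw k (inversion (dep π) (q ∘ π) i.castSucc i.succ) := by
        -- For fixed `π`, passing from queues of tasks to queues of labels is a bijection of
        -- assignments.
        refine Finset.sum_congr rfl fun π _ => ?_
        refine Fintype.sum_equiv (π.arrowCongr (Equiv.refl _)) _ _ fun q => ?_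
        rw [show (π.arrowCongr (Equiv.refl _) q) ∘ π = q by ext i; simp [Equiv.arrowCongr]]
    _ ≤ _ := Finset.sum_le_sum fun π _ => Finset.sum_le_sum fun q _ =>
        sum_inversion_le_lintegral (dep π) (q ∘ π)

end MultiQueue

end

/-! ### Ancestors in binary search trees -/

namespace BSTSort

variable {K : Type*} [LinearOrder K]

theorem mem_insert {x y : K} {T : BinaryTree K} : Mem x (insert y T) ↔ x = y ∨ Mem x T := by
  induction T with
  | nil => simp [insert, Mem]
  | node z l r ihl ihr =>
    simp only [insert]
    split_ifs
    · simp only [Mem, ihl]; tauto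
    · simp only [Mem, ihr]; tauto

/-- Insertion only adds a leaf, so existing ancestor relations persist. -/
theorem IsAncestor.insert {x y z : K} {T : BinaryTree K} (h : IsAncestor x y T) :
    IsAncestor x y (BSTSort.insert z T) := by
  induction T with
  | nil => exact h.elim
  | node w l r ihl ihr =>
    simp only [BSTSort.insert]
    simp only [IsAncestor] at h
    split_ifs
    · simp only [IsAncestor, mem_insert]
      rcases h with ⟨rfl, h | h⟩ | h | h
      · exact Or.inl ⟨rfl, Or.inl (Or.inr h)⟩
      · exact Or.inl ⟨rfl, Or.inr h⟩
      · exact Or.inr (Or.inl (ihl h))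
      · exact Or.inr (Or.inr h)
    · simp only [IsAncestor, mem_insert]
      rcases h with ⟨rfl, h | h⟩ | h | h
      · exact Or.inl ⟨rfl, Or.inl h⟩
      · exact Or.inl ⟨rfl, Or.inr (Or.inr h)⟩
      · exact Or.inr (Or.inl h)
      · exact Or.inr (Or.inr (ihr h))

/-- If no key of the tree separates `u` and `v`, then `u` becomes an ancestor of `v` when the two
are inserted one after the other. -/
theorem isAncestor_insert_insert {u v : K} {T : BinaryTree K}
    (h : ∀ y, Mem y T → (u < y ↔ v < y)) : IsAncestor u v (insert v (insert u T)) := by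
  induction T with
  | nil =>
    simp only [insert]
    split_ifs <;> simp [IsAncestor, Mem]
  | node y l r ihl ihr =>
    have hy := h y (Or.inl rfl)
    by_cases hu : u < y
    · simp only [insert, if_pos hu, if_pos (hy.1 hu)]
      exact Or.inr (Or.inl (ihl fun z hz => h z (Or.inr (Or.inl hz))))
    · simp only [insert, if_neg hu, if_neg (fun hv => hu (hy.2 hv))]
      exact Or.inr (Or.inr (ihr fun z hz => h z (Or.inr (Or.inr hz))))

theorem mem_foldl_insert {x : K} (xs : List K) (T : BinaryTree K) :
    Mem x (xs.foldl (fun T x => insert x T) T) ↔ x ∈ xs ∨ Mem x T := by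
  induction xs generalizing T with
  | nil => simp
  | cons y ys ih => simp only [List.foldl_cons, ih, mem_insert, List.mem_cons]; tauto

theorem mem_build {x : K} {xs : List K} : Mem x (build xs) ↔ x ∈ xs := by
  simp [build, mem_foldl_insert, Mem]

theorem isAncestor_build {u v : K} {xs ys : List K} (h : ∀ y ∈ xs, (u < y ↔ v < y)) :
    IsAncestor u v (build (xs ++ u :: v :: ys)) := by
  have h0 : IsAncestor u v (insert v (insert u (build xs))) :=
    isAncestor_insert_insert fun y hy => h y (mem_build.1 hy)
  unfold build at h0 ⊢
  rw [List.foldl_append, List.foldl_cons, List.foldl_cons]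
  generalize insert v _ = T at h0 ⊢
  induction ys generalizing T with
  | nil => exact h0
  | cons y ys ih => exact ih _ h0.insert

/-- The consecutive labels `i` and `i + 1` are dependent if no key of a smaller label separates
their keys. -/
theorem dep_of_forall_lt {m : ℕ} (key : Fin (m + 1) → K) (π : Equiv.Perm (Fin (m + 1)))
    (i : Fin m) (h : ∀ l < i.castSucc,
      (key (π i.castSucc) < key (π l) ↔ key (π i.succ) < key (π l))) :
    dep key π i.castSucc i.succ := by
  unfold dep
  set L := List.ofFn fun l => key (π l) with hL
  have hlen : L.length = m + 1 := by simp [hL]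
  have hi1 : (i : ℕ) < L.length := by omega
  have hi2 : (i : ℕ) + 1 < L.length := by omega
  have e : L = L.take i ++ key (π i.castSucc) :: key (π i.succ) :: L.drop (i + 2) := by
    conv_lhs => rw [← List.take_append_drop i L, List.drop_eq_getElem_cons hi1,
      List.drop_eq_getElem_cons hi2]
    congr 2
    · simp [hL, -List.ofFn_succ]; rfl
    · congr 1
      simp [hL, -List.ofFn_succ]; rfl
  rw [e]
  refine isAncestor_build fun y hy => ?_
  obtain ⟨l, hl, rfl⟩ := List.mem_take_iff_getElem.1 hy
  rw [lt_min_iff] at hl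
  have := h ⟨l, by omega⟩ (by rw [Fin.lt_def]; simpa using hl.1)
  simpa [hL, -List.ofFn_succ] using this

/-- Among finitely many keys other than `v` there is one that is not separated from `v`. -/
theorem exists_adjacent {ι : Type*} (A : Finset ι) (hA : A.Nonempty) (f : ι → K) (v : K)
    (hf : Set.InjOn f A) (hv : ∀ i ∈ A, f i ≠ v) :
    ∃ l ∈ A, ∀ j ∈ A, j ≠ l → (f l < f j ↔ v < f j) := by
  -- Take the predecessor of `v` among the keys, or its successor if no key is smaller.
  by_cases h : (A.filter fun i => f i < v).Nonempty
  · obtain ⟨l, hl, hmax⟩ := Finset.exists_max_image _ f h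
    rw [Finset.mem_filter] at hl
    refine ⟨l, hl.1, fun j hj hjl => ⟨fun hlt => ?_, fun hlt => hl.2.trans hlt⟩⟩
    by_contra hcon
    have hjv : f j < v := lt_of_le_of_ne (not_lt.1 hcon) (hv j hj)
    exact absurd (hmax j (Finset.mem_filter.2 ⟨hj, hjv⟩)) (not_le.2 hlt)
  · obtain ⟨l, hl, hmin⟩ := Finset.exists_min_image A f hA
    have hgt : ∀ j ∈ A, v < f j := fun j hj => by
      refine lt_of_le_of_ne (not_lt.1 fun hlt => h ⟨j, Finset.mem_filter.2 ⟨hj, hlt⟩⟩)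
        (hv j hj).symm
    refine ⟨l, hl, fun j hj hjl => ⟨fun _ => hgt j hj, fun _ => ?_⟩⟩
    exact lt_of_le_of_ne (hmin j hj) fun e => hjl (hf hl hj e).symm

theorem exists_swap_dep {m : ℕ} (key : Fin (m + 1) → K) (hkey : Function.Injective key)
    (π : Equiv.Perm (Fin (m + 1))) (i : Fin m) : ∃ l ≤ i.castSucc,
      dep key ((Equiv.swap l i.castSucc).trans π) i.castSucc i.succ := by
  obtain ⟨l, hl, hadj⟩ := exists_adjacent (Finset.Iic i.castSucc) ⟨_, Finset.mem_Iic.2 le_rfl⟩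
    (fun l => key (π l)) (key (π i.succ)) ((hkey.comp π.injective).injOn) (fun j hj e => by
      have : j = i.succ := (hkey.comp π.injective) e
      rw [this, Finset.mem_Iic] at hj
      exact absurd hj (not_le.2 Fin.castSucc_lt_succ))
  rw [Finset.mem_Iic] at hl
  refine ⟨l, hl, dep_of_forall_lt key _ i fun j hj => ?_⟩
  have hs : Equiv.swap l i.castSucc i.succ = i.succ :=
    Equiv.swap_apply_of_ne_of_ne (hl.trans_lt Fin.castSucc_lt_succ).ne'
      Fin.castSucc_lt_succ.ne'
  simp only [Equiv.trans_apply, Equiv.swap_apply_right, hs]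
  refine hadj _ ?_ ?_
  · rw [Finset.mem_Iic, Equiv.swap_apply_def]
    split_ifs
    · exact le_rfl
    · exact hl
    · exact hj.le
  · intro e
    rw [Equiv.swap_apply_eq_iff, Equiv.swap_apply_left] at e
    exact hj.ne e

end BSTSort

/-! ### Delaunay triangles and the power of a point -/

noncomputable section

namespace Delaunay

/-- The power of the point `p` with respect to the circle with centre `c` and radius `r`. -/
def power (c : Plane) (r : ℝ) (p : Plane) : ℝ := dist p c ^ 2 - r ^ 2

/-- The power of a point with respect to the circumcircle of a triangle. -/
abbrev circumpower (t : Affine.Triangle ℝ Plane) (p : Plane) : ℝ :=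
  power t.circumcenter t.circumradius p

theorem encroaches_iff {p : Plane} {t : Affine.Triangle ℝ Plane} :
    Encroaches p t ↔ circumpower t p < 0 := by
  have hr : 0 ≤ t.circumradius := t.circumradius_nonneg
  rw [Encroaches, Metric.mem_ball, circumpower, power, sub_neg, sq_lt_sq₀ dist_nonneg hr]

theorem circumpower_points (t : Affine.Triangle ℝ Plane) (i : Fin 3) :
    circumpower t (t.points i) = 0 := by
  rw [circumpower, power, t.dist_circumcenter_eq_circumradius, sub_self]

/-- The power is the squared norm plus an affine function, so its deviation from affinity does not
depend on the circle. -/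
theorem sum_mul_power {ι : Type*} [Fintype ι] (c : Plane) (r : ℝ) {w : ι → ℝ} {p : ι → Plane}
    {x : Plane} (hw : ∑ i, w i = 1) (hx : ∑ i, w i • p i = x) :
    ∑ i, w i * power c r (p i) = power c r x + ∑ i, w i * dist (p i) x ^ 2 := by
  have h0 : ∑ i, w i • (p i - x) = 0 := by
    simp only [smul_sub, Finset.sum_sub_distrib, hx, ← Finset.sum_smul, hw, one_smul, sub_self]
  have h1 : ∑ i, w i * inner ℝ (p i - x) (x - c) = 0 := by
    simp only [← real_inner_smul_left, ← sum_inner, h0, inner_zero_left]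
  have h2 : ∀ i, w i * power c r (p i) = w i * dist (p i) x ^ 2 +
      2 * (w i * inner ℝ (p i - x) (x - c)) + w i * power c r x := by
    intro i
    have : dist (p i) c ^ 2 = dist (p i) x ^ 2 + 2 * inner ℝ (p i - x) (x - c) + dist x c ^ 2 := by
      rw [dist_eq_norm, dist_eq_norm, dist_eq_norm, ← norm_add_sq_real, sub_add_sub_cancel]
    rw [power, power, this]
    ring
  simp only [h2, Finset.sum_add_distrib, ← Finset.mul_sum, h1, ← Finset.sum_mul, hw]
  ring

/-- The difference of two power functions is affine. -/
theorem sum_mul_power_sub {ι : Type*} [Fintype ι] (c c' : Plane) (r r' : ℝ) {w : ι → ℝ}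
    {p : ι → Plane} {x : Plane} (hw : ∑ i, w i = 1) (hx : ∑ i, w i • p i = x) :
    ∑ i, w i * (power c r (p i) - power c' r' (p i)) = power c r x - power c' r' x := by
  simp only [mul_sub, Finset.sum_sub_distrib, sum_mul_power _ _ hw hx]
  ring

/-- The vertices of a triangle as an affine basis of the plane. -/
def basis (t : Affine.Triangle ℝ Plane) : AffineBasis (Fin 3) ℝ Plane :=
  ⟨t.points, t.independent, by
    rw [t.independent.affineSpan_eq_top_iff_card_eq_finrank_add_one]
    simp⟩

theorem basis_apply (t : Affine.Triangle ℝ Plane) (i : Fin 3) : basis t i = t.points i := rfl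

/-- The barycentric coordinates with respect to a triangle. -/
abbrev coord (t : Affine.Triangle ℝ Plane) (i : Fin 3) : Plane →ᵃ[ℝ] ℝ := (basis t).coord i

theorem sum_coord (t : Affine.Triangle ℝ Plane) (x : Plane) : ∑ i, coord t i x = 1 :=
  (basis t).sum_coord_apply_eq_one x

theorem sum_coord_smul (t : Affine.Triangle ℝ Plane) (x : Plane) :
    ∑ i, coord t i x • t.points i = x :=
  (basis t).linear_combination_coord_eq_self x

theorem coord_eq_of_sum (t : Affine.Triangle ℝ Plane) {x : Plane} {w : Fin 3 → ℝ}
    (hw : ∑ i, w i = 1) (hx : ∑ i, w i • t.points i = x) (i : Fin 3) : coord t i x = w i := by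
  rw [← hx, ← Finset.affineCombination_eq_linear_combination _ t.points w hw]
  exact (basis t).coord_apply_combination_of_mem (Finset.mem_univ i) hw

theorem coord_pos_of_mem_interior {t : Affine.Triangle ℝ Plane} {x : Plane}
    (hx : x ∈ t.interior) (i : Fin 3) : 0 < coord t i x := by
  obtain ⟨w, hw, hI, rfl⟩ := hx
  have : coord t i (Finset.univ.affineCombination ℝ t.points w) = w i :=
    (basis t).coord_apply_combination_of_mem (Finset.mem_univ i) hw
  rw [this]
  exact (hI i).1

/-- The closed triangle spanned by the vertices of `t`. -/
def closedTriangle (t : Affine.Triangle ℝ Plane) : Set Plane := {x | ∀ i, 0 ≤ coord t i x}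

theorem isClosed_closedTriangle (t : Affine.Triangle ℝ Plane) : IsClosed (closedTriangle t) := by
  simp only [closedTriangle, Set.ofPred_forall]
  exact isClosed_iInter fun i =>
    isClosed_le continuous_const (continuous_barycentric_coord (basis t) i)

theorem encroaches_of_mem_closedTriangle {t : Affine.Triangle ℝ Plane} {x : Plane}
    (hx : x ∈ closedTriangle t) (hne : x ∉ Set.range t.points) : Encroaches x t := by
  rw [encroaches_iff]
  have h := sum_mul_power t.circumcenter t.circumradius (sum_coord t x) (sum_coord_smul t x)
  simp only [circumpower_points, mul_zero, Finset.sum_const_zero] at h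
  have hpos : 0 < ∑ i, coord t i x * dist (t.points i) x ^ 2 := by
    obtain ⟨i, -, hi⟩ : ∃ i ∈ Finset.univ, 0 < coord t i x := by
      by_contra! hcon
      have := Finset.sum_nonpos hcon
      rw [sum_coord] at this
      linarith
    refine Finset.sum_pos' (fun j _ => mul_nonneg (hx j) (sq_nonneg _)) ⟨i, Finset.mem_univ i, ?_⟩
    exact mul_pos hi (pow_pos (dist_pos.2 fun e => hne ⟨i, e⟩) 2)
  linarith

/-- The line through the two vertices other than `t.points i`. -/
def edgeLine (t : Affine.Triangle ℝ Plane) (i : Fin 3) : AffineSubspace ℝ Plane :=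
  (affineSpan ℝ {(0 : ℝ)}).comap (coord t i)

theorem mem_edgeLine {t : Affine.Triangle ℝ Plane} {i : Fin 3} {x : Plane} :
    x ∈ edgeLine t i ↔ coord t i x = 0 := by
  rw [edgeLine, AffineSubspace.mem_comap, AffineSubspace.mem_affineSpan_singleton]

theorem volume_edgeLine (t : Affine.Triangle ℝ Plane) (i : Fin 3) :
    volume (edgeLine t i : Set Plane) = 0 := by
  refine Measure.addHaar_affineSubspace _ _ fun h => ?_
  have h1 : t.points i ∈ edgeLine t i := by rw [h]; exact AffineSubspace.mem_top _ _ _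
  rw [mem_edgeLine, ← basis_apply, AffineBasis.coord_apply_eq] at h1
  exact one_ne_zero h1

theorem affineIndependent_update {t : Affine.Triangle ℝ Plane} {i : Fin 3} {p : Plane}
    (hp : coord t i p ≠ 0) : AffineIndependent ℝ (Function.update t.points i p) := by
  refine t.independent.affineIndependent_update_of_notMem_affineSpan fun hmem => hp ?_
  rw [← mem_edgeLine]
  refine affineSpan_le.2 ?_ hmem
  rintro _ ⟨j, hj, rfl⟩
  exact mem_edgeLine.2 ((basis t).coord_apply_ne (Ne.symm hj))

/-- If a point `p` encroaches on a triangle with `x` in its interior, then one vertex can be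
replaced by `p` such that the closed triangle still contains `x`, which gains power. -/
theorem exists_pivot {t : Affine.Triangle ℝ Plane} {x p : Plane} (hx : ∀ i, 0 < coord t i x)
    (hp : Encroaches p t) : ∃ t' : Affine.Triangle ℝ Plane,
      Set.range t'.points ⊆ insert p (Set.range t.points) ∧ x ∈ closedTriangle t' ∧
        circumpower t x < circumpower t' x := by
  have hne : (Finset.univ.filter fun i => 0 < coord t i p).Nonempty := by
    by_contra hcon
    have h : ∀ i ∈ Finset.univ, coord t i p ≤ 0 := fun i hi => not_lt.1 fun hlt =>
      hcon ⟨i, Finset.mem_filter.2 ⟨hi, hlt⟩⟩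
    have := Finset.sum_nonpos h
    rw [sum_coord] at this
    linarith
  -- The ratio test of the simplex method: the minimal ratio `θ` is the largest weight that `p` can
  -- get while the other weights stay nonnegative, and vertex `i` then gets weight zero.
  obtain ⟨i, hi, hmin⟩ := Finset.exists_min_image _ (fun i => coord t i x / coord t i p) hne
  replace hi := (Finset.mem_filter.1 hi).2
  set θ := coord t i x / coord t i p with hθ
  have hθpos : 0 < θ := div_pos (hx i) hi
  have hθi : θ * coord t i p = coord t i x := div_mul_cancel₀ _ hi.ne'
  have hle : ∀ j, 0 ≤ coord t j x - θ * coord t j p := by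
    intro j
    rcases lt_or_ge 0 (coord t j p) with hj | hj
    · have := hmin j (Finset.mem_filter.2 ⟨Finset.mem_univ j, hj⟩)
      rw [le_div_iff₀ hj] at this
      linarith
    · have := hx j
      nlinarith
  set v : Fin 3 → ℝ := fun j => coord t j x - θ * coord t j p with hv
  have hvi : v i = 0 := by simp [hv, hθi]
  set w : Fin 3 → ℝ := Function.update v i θ with hwdef
  let t' : Affine.Triangle ℝ Plane := ⟨Function.update t.points i p, affineIndependent_update hi.ne'⟩
  have hsplit : ∀ {M : Type} [AddCommGroup M] (f g : Fin 3 → M), f i = 0 →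
      (∀ j ≠ i, g j = f j) → ∑ j, g j = ∑ j, f j + g i := by
    intro M _ f g hf hfg
    rw [← Finset.add_sum_erase _ g (Finset.mem_univ i), ← Finset.add_sum_erase _ f
      (Finset.mem_univ i), hf, zero_add, add_comm]
    congr 1
    exact Finset.sum_congr rfl fun j hj => hfg j (Finset.ne_of_mem_erase hj)
  have hw : ∑ j, w j = 1 := by
    rw [hsplit v w hvi fun j hj => Function.update_of_ne hj _ _]
    simp only [hv, Finset.sum_sub_distrib, ← Finset.mul_sum, sum_coord, hwdef,
      Function.update_self]
    ring
  have hwx : ∑ j, w j • t'.points j = x := by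
    rw [hsplit (fun j => v j • t.points j) (fun j => w j • t'.points j) (by simp [hvi])
      fun j hj => by simp [w, t', Function.update_of_ne hj]]
    simp only [hv, sub_smul, mul_smul, Finset.sum_sub_distrib, ← Finset.smul_sum, sum_coord_smul]
    simp [w, t']
  refine ⟨t', ?_, fun j => ?_, ?_⟩
  · rintro _ ⟨j, rfl⟩
    by_cases hj : j = i
    · subst hj; simp [t']
    · simp [t', Function.update_of_ne hj]
  · rw [coord_eq_of_sum t' hw hwx]
    by_cases hj : j = i
    · subst hj; simp [w, hθpos.le]
    · rw [show w j = v j from Function.update_of_ne hj _ _]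
      exact hle j
  -- The difference of the two powers is affine, vanishes at the two common vertices and is negative
  -- at `p`, which has positive weight `θ`.
  · have h := sum_mul_power_sub t.circumcenter t'.circumcenter t.circumradius t'.circumradius
      hw hwx
    simp only [circumpower_points, sub_zero] at h
    rw [hsplit (fun _ => (0 : ℝ)) _ rfl fun j hj => ?_] at h
    · have hp' := encroaches_iff.1 hp
      have hneg : w i * circumpower t (t'.points i) < 0 := by
        simp only [w, t', Function.update_self]
        exact mul_neg_of_pos_of_neg hθpos hp'
      simp only [Finset.sum_const_zero, zero_add] at h
      linarith
    · simp [t', Function.update_of_ne hj, circumpower_points]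

theorem finite_triangles {S : Set Plane} (hS : S.Finite) :
    {t : Affine.Triangle ℝ Plane | Set.range t.points ⊆ S}.Finite := by
  refine Set.Finite.of_finite_image (f := fun t => t.points)
    ((Set.Finite.pi' (fun _ : Fin 3 => hS)).subset ?_) ?_
  · rintro _ ⟨t, ht, rfl⟩ i
    exact ht ⟨i, rfl⟩
  · intro t _ t' _ h
    exact Affine.Simplex.ext fun i => congrFun h i

/-- The triangles of the mesh cover the interior of a triangle with vertices in `S`. -/
theorem exists_mem_mesh {S : Set Plane} (hS : S.Finite) {T : Affine.Triangle ℝ Plane}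
    (hT : Set.range T.points ⊆ S) {x : Plane} (hx : ∀ i, 0 < coord T i x) :
    ∃ t ∈ mesh S, x ∈ closedTriangle t := by
  -- Pivoting needs strictly positive coordinates, so points off all edge lines are covered first.
  -- They are dense, and the finite union of closed triangles is closed.
  have hgen : ∀ᵐ y : Plane, ∀ t ∈ {t : Affine.Triangle ℝ Plane | Set.range t.points ⊆ S},
      ∀ i, coord t i y ≠ 0 := by
    rw [ae_ball_iff (finite_triangles hS).countable]
    intro t _
    rw [ae_all_iff]
    intro i
    refine measure_mono_null (fun y hy => ?_) (volume_edgeLine t i)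
    exact mem_edgeLine.2 (not_not.1 hy)
  have hopen : IsOpen {y : Plane | ∀ i, 0 < coord T i y} := by
    simp only [Set.ofPred_forall]
    exact isOpen_iInter_of_finite fun i =>
      isOpen_lt continuous_const (continuous_barycentric_coord (basis T) i)
  have hclosed : IsClosed (⋃ t ∈ mesh S, closedTriangle t) :=
    ((finite_triangles hS).subset fun t ht => ht.1).isClosed_biUnion
      fun t _ => isClosed_closedTriangle t
  have hsub := closure_minimal (s := {y : Plane | ∀ i, 0 < coord T i y} ∩
      {y | ∀ t ∈ {t : Affine.Triangle ℝ Plane | Set.range t.points ⊆ S}, ∀ i, coord t i y ≠ 0})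
    (t := ⋃ t ∈ mesh S, closedTriangle t) ?_ hclosed
  · have := hsub ((Measure.dense_of_ae hgen).open_subset_closure_inter hopen hx)
    simpa using this
  rintro y ⟨hyT, hy⟩
  -- Among the triangles containing `y`, one with maximal power at `y` is Delaunay: an encroaching
  -- vertex would allow a pivot that increases the power.
  obtain ⟨t, ⟨htS, hyt⟩, hmax⟩ := Set.exists_max_image
    {t : Affine.Triangle ℝ Plane | Set.range t.points ⊆ S ∧ y ∈ closedTriangle t}
    (fun t => circumpower t y) ((finite_triangles hS).subset fun t ht => ht.1)
    ⟨T, hT, fun i => (hyT i).le⟩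
  refine Set.mem_biUnion (x := t) ⟨htS, fun p hp henc => ?_⟩ hyt
  obtain ⟨t', ht'S, hyt', hlt⟩ :=
    exists_pivot (fun i => lt_of_le_of_ne (hyt i) (hy t htS i).symm) henc
  exact absurd (hmax t' ⟨ht'S.trans (Set.insert_subset hp htS), hyt'⟩) (not_le.2 hlt)

/-- If a vertex lies on the circumcircle of another triangle, it is a vertex of it. -/
theorem mem_range_of_circumpower_eq_zero {V : Set Plane} (hV : NoFourConcyclic V)
    {t : Affine.Triangle ℝ Plane} (ht : Set.range t.points ⊆ V) {a : Plane} (ha : a ∈ V)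
    (h : circumpower t a = 0) : a ∈ Set.range t.points := by
  by_contra hcon
  refine hV (insert a (Set.range t.points)) (Set.insert_subset ha ht) ?_
    ⟨t.circumcenter, t.circumradius, ?_⟩
  · rw [Set.encard_insert_of_notMem hcon, ← Set.image_univ,
      t.independent.injective.encard_image, Set.encard_univ]
    simp
    norm_num
  · rintro p (rfl | ⟨i, rfl⟩)
    · rw [circumpower, power, sub_eq_zero] at h
      exact (pow_left_inj₀ dist_nonneg t.circumradius_nonneg two_ne_zero).1 h
    · exact t.dist_circumcenter_eq_circumradius i

/-- Two triangles of the mesh whose closed triangles share a point that is not a vertex have two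
vertices in common. -/
theorem exists_common_edge {S V : Set Plane} (hV : NoFourConcyclic V) (hSV : S ⊆ V)
    {t t' : Affine.Triangle ℝ Plane} (ht : t ∈ mesh S) (ht' : t' ∈ mesh S) {x : Plane}
    (hx : x ∈ closedTriangle t) (hx' : x ∈ closedTriangle t') (hxS : x ∉ S) :
    ∃ a b : Plane, a ≠ b ∧ a ∈ Set.range t.points ∧ b ∈ Set.range t.points ∧
      a ∈ Set.range t'.points ∧ b ∈ Set.range t'.points := by
  have key : ∀ {s s' : Affine.Triangle ℝ Plane}, ∑ i, coord s i x * circumpower s' (s.points i) =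
      circumpower s' x - circumpower s x := by
    intro s s'
    rw [← sum_mul_power_sub s'.circumcenter s.circumcenter s'.circumradius s.circumradius
      (sum_coord s x) (sum_coord_smul s x)]
    simp only [circumpower_points, sub_zero]
  have hnonneg : ∀ {s s' : Affine.Triangle ℝ Plane}, s ∈ mesh S → s' ∈ mesh S →
      x ∈ closedTriangle s → ∀ i ∈ Finset.univ, 0 ≤ coord s i x * circumpower s' (s.points i) :=
    fun hs hs' hxs i _ => mul_nonneg (hxs i)
      (not_lt.1 fun hlt => hs'.2 _ (hs.1 ⟨i, rfl⟩) (encroaches_iff.2 hlt))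
  have h1 := Finset.sum_nonneg (hnonneg ht ht' hx)
  have h2 := Finset.sum_nonneg (hnonneg ht' ht hx')
  -- The two nonnegative sums are negatives of each other, so every term vanishes: vertices of `t`
  -- with nonzero weight lie on the circumcircle of `t'`. At least two such vertices exist because
  -- `x` is not a vertex.
  have h3 : ∑ i, coord t i x * circumpower t' (t.points i) = 0 := by
    rw [key] at h1 h2 ⊢
    linarith
  have hmem : ∀ i, coord t i x ≠ 0 → t.points i ∈ Set.range t'.points := by
    intro i hi
    have := (Finset.sum_eq_zero_iff_of_nonneg (hnonneg ht ht' hx)).1 h3 i (Finset.mem_univ i)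
    exact mem_range_of_circumpower_eq_zero hV (ht'.1.trans hSV) (hSV (ht.1 ⟨i, rfl⟩))
      ((mul_eq_zero.1 this).resolve_left hi)
  obtain ⟨i, hi⟩ : ∃ i, coord t i x ≠ 0 := by
    by_contra! hcon
    have := sum_coord t x
    simp [hcon] at this
  obtain ⟨j, hj, hij⟩ : ∃ j, coord t j x ≠ 0 ∧ i ≠ j := by
    by_contra! hcon
    have h0 : ∀ j ≠ i, coord t j x = 0 := fun j hji => by
      by_contra hne
      exact hji (hcon j hne).symm
    have e1 := sum_coord t x
    have e2 := sum_coord_smul t x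
    rw [Finset.sum_eq_single i (fun j _ hji => h0 j hji) (by simp)] at e1
    rw [Finset.sum_eq_single i (fun j _ hji => by rw [h0 j hji, zero_smul]) (by simp), e1,
      one_smul] at e2
    exact hxS (ht.1 ⟨i, e2⟩)
  exact ⟨t.points i, t.points j, fun e => hij (t.independent.injective e), ⟨i, rfl⟩, ⟨j, rfl⟩,
    hmem i hi, hmem j hj⟩

/-- A triangle that meets the segment `uv`, and has its vertices outside of the disk with
diameter `uv`, is encroached by `u` or `v`. -/
theorem encroaches_or_encroaches {t : Affine.Triangle ℝ Plane} {u v x : Plane}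
    (hx : x ∈ segment ℝ u v) (hxt : x ∈ closedTriangle t)
    (ht : ∀ i, t.points i ∉ Metric.closedBall (midpoint ℝ u v) (dist u v / 2)) :
    Encroaches u t ∨ Encroaches v t := by
  by_contra! hcon
  simp only [encroaches_iff, not_lt] at hcon
  obtain ⟨hu, hv⟩ := hcon
  obtain ⟨a, b, ha, hb, hab, hxab⟩ := hx
  have hu0 : power (midpoint ℝ u v) (dist u v / 2) u = 0 := by
    rw [power, dist_left_midpoint]; norm_num; ring
  have hv0 : power (midpoint ℝ u v) (dist u v / 2) v = 0 := by
    rw [power, dist_right_midpoint]; norm_num; ring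
  -- The difference of the powers for the circumcircle and the diametral circle is affine. Evaluated
  -- at `x` through `u` and `v` it is nonnegative; through the vertices of `t`, all outside the
  -- disk, it is negative.
  have h1 := sum_mul_power_sub t.circumcenter (midpoint ℝ u v) t.circumradius (dist u v / 2)
    (w := ![a, b]) (p := ![u, v]) (x := x) (by simpa using hab) (by simpa using hxab)
  have h2 := sum_mul_power_sub t.circumcenter (midpoint ℝ u v) t.circumradius (dist u v / 2)
    (sum_coord t x) (sum_coord_smul t x)
  rw [Fin.sum_univ_two] at h1
  simp only [Matrix.cons_val_zero, Matrix.cons_val_one, hu0, hv0, sub_zero] at h1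
  have h3 : 0 ≤ a * circumpower t u + b * circumpower t v := by positivity
  have h4 : ∀ i, 0 < power (midpoint ℝ u v) (dist u v / 2) (t.points i) := by
    intro i
    have := ht i
    rw [Metric.mem_closedBall, not_le] at this
    rw [power, sub_pos]
    exact pow_lt_pow_left₀ this (by positivity) two_ne_zero
  have h5 : ∑ i, coord t i x * (circumpower t (t.points i) -
      power (midpoint ℝ u v) (dist u v / 2) (t.points i)) < 0 := by
    obtain ⟨i, hi⟩ : ∃ i, 0 < coord t i x := by
      by_contra! hneg
      have := Finset.sum_nonpos fun i (_ : i ∈ Finset.univ) => hneg i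
      rw [sum_coord] at this
      linarith
    simp only [circumpower_points, zero_sub, mul_neg, Finset.sum_neg_distrib, neg_lt_zero]
    exact Finset.sum_pos' (fun j _ => mul_nonneg (hxt j) (h4 j).le)
      ⟨i, Finset.mem_univ i, mul_pos hi (h4 i)⟩
  linarith

/-- If the disk with diameter `uv` contains no vertex of the mesh, then the encroaching regions
of `u` and `v` overlap by an edge. -/
theorem overlap_of_disjoint_closedBall {S V : Set Plane} (hS : S.Finite) (hSV : S ⊆ V)
    (hV : NoFourConcyclic V) {T : Affine.Triangle ℝ Plane} (hT : Set.range T.points ⊆ S)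
    {u v : Plane} (hu : u ∈ T.interior) (hv : v ∈ T.interior)
    (hdisk : ∀ p ∈ S, p ∉ Metric.closedBall (midpoint ℝ u v) (dist u v / 2)) :
    Overlap S u v := by
  have hfin : ∀ p, {t ∈ mesh S | Encroaches p t}.Finite := fun p =>
    (finite_triangles hS).subset fun t ht => ht.1.1
  have hclosed : ∀ p, IsClosed (⋃ t ∈ {t ∈ mesh S | Encroaches p t}, closedTriangle t) := fun p =>
    (hfin p).isClosed_biUnion fun t _ => isClosed_closedTriangle t
  have hpos : ∀ x ∈ segment ℝ u v, ∀ i, 0 < coord T i x := fun x hx i =>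
    ((convex_Ioi (0 : ℝ)).affine_preimage (coord T i)).segment_subset
      (coord_pos_of_mem_interior hu i) (coord_pos_of_mem_interior hv i) hx
  have hnotMem : ∀ x ∈ segment ℝ u v, x ∉ S := by
    intro x hx hxS
    refine hdisk x hxS ((convex_closedBall _ _).segment_subset ?_ ?_ hx)
    · rw [Metric.mem_closedBall, dist_left_midpoint]; norm_num; linarith
    · rw [Metric.mem_closedBall, dist_right_midpoint]; norm_num; linarith
  have hend : ∀ p ∈ segment ℝ u v,
      p ∈ ⋃ t ∈ {t ∈ mesh S | Encroaches p t}, closedTriangle t := by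
    intro p hp
    obtain ⟨t, ht, hpt⟩ := exists_mem_mesh hS hT (hpos p hp)
    exact Set.mem_biUnion (x := t) ⟨ht, encroaches_of_mem_closedTriangle hpt
      fun h => hnotMem p hp (ht.1 h)⟩ hpt
  -- The closed regions encroached by `u` and by `v` cover the connected segment, and each contains
  -- an endpoint, so they meet on it.
  obtain ⟨x, hx, hxu, hxv⟩ := isPreconnected_closed_iff.1 (convex_segment u v).isPreconnected
    _ _ (hclosed u) (hclosed v) (fun x hx => by
      obtain ⟨t, ht, hxt⟩ := exists_mem_mesh hS hT (hpos x hx)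
      rcases encroaches_or_encroaches hx hxt (fun i => hdisk _ (ht.1 ⟨i, rfl⟩)) with h | h
      · exact Or.inl (Set.mem_biUnion (x := t) ⟨ht, h⟩ hxt)
      · exact Or.inr (Set.mem_biUnion (x := t) ⟨ht, h⟩ hxt))
    ⟨u, left_mem_segment ℝ u v, hend u (left_mem_segment ℝ u v)⟩
    ⟨v, right_mem_segment ℝ u v, hend v (right_mem_segment ℝ u v)⟩
  obtain ⟨t, ht, hxt⟩ := Set.mem_iUnion₂.1 hxu
  obtain ⟨t', ht', hxt'⟩ := Set.mem_iUnion₂.1 hxv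
  exact ⟨t, ht, t', ht', exists_common_edge hV hSV ht.1 ht'.1 hxt hxt' (hnotMem x hx)⟩

/-! ### Nearest points and Delaunay dependence -/

/-- By the median formula, a point of the disk with diameter `uv` has squared distances to `u` and
`v` summing to at most that of `uv`; if it is not `u`, it is strictly closer to `v` than `u` is. -/
theorem notMem_closedBall_of_dist_le {u v p : Plane} (hpu : p ≠ u) (h : dist u v ≤ dist p v) :
    p ∉ Metric.closedBall (midpoint ℝ u v) (dist u v / 2) := by
  rw [Metric.mem_closedBall, not_le]
  by_contra! hle
  have e := EuclideanGeometry.dist_sq_add_dist_sq_eq_two_mul_dist_midpoint_sq_add_half_dist_sq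
    p u v
  have h1 : 0 < dist p u := dist_pos.2 hpu
  have h2 : dist p (midpoint ℝ u v) ^ 2 ≤ (dist u v / 2) ^ 2 :=
    pow_le_pow_left₀ dist_nonneg hle 2
  have h3 : dist u v ^ 2 ≤ dist p v ^ 2 := pow_le_pow_left₀ dist_nonneg h 2
  have h4 : 0 < dist p u ^ 2 := pow_pos h1 2
  nlinarith

/-- Label `i` goes to the point nearest to the one labelled `i + 1`. The earlier points are then
outside the diametral disk, and `IsBounding` keeps the vertices of `T` out. -/
theorem exists_swap_dep {m : ℕ} (P : Fin (m + 1) → Plane) (T : Affine.Triangle ℝ Plane)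
    (hP : Function.Injective P) (hT : IsBounding P T)
    (hV : NoFourConcyclic (Set.range P ∪ Set.range T.points))
    (π : Equiv.Perm (Fin (m + 1))) (i : Fin m) : ∃ l ≤ i.castSucc,
      dep P T ((Equiv.swap l i.castSucc).trans π) i.castSucc i.succ := by
  obtain ⟨l, hl, hmin⟩ := Finset.exists_min_image (Finset.Iic i.castSucc)
    (fun l => dist (P (π l)) (P (π i.succ))) ⟨_, Finset.mem_Iic.2 le_rfl⟩
  rw [Finset.mem_Iic] at hl
  refine ⟨l, hl, ?_⟩
  have hs : Equiv.swap l i.castSucc i.succ = i.succ :=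
    Equiv.swap_apply_of_ne_of_ne (hl.trans_lt Fin.castSucc_lt_succ).ne'
      Fin.castSucc_lt_succ.ne'
  have hfin : {p | ∃ j < i.castSucc,
      p = P (((Equiv.swap l i.castSucc).trans π) j)}.Finite := by
    refine (Set.finite_range P).subset ?_
    rintro _ ⟨j, -, rfl⟩
    exact ⟨_, rfl⟩
  unfold dep before
  rw [Equiv.trans_apply, Equiv.swap_apply_right, Equiv.trans_apply, hs]
  refine overlap_of_disjoint_closedBall (T := T) ((Set.finite_range _).union hfin) ?_ hV
    Set.subset_union_left (hT.1 _) (hT.1 _) ?_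
  · rintro p (h | ⟨j, -, rfl⟩)
    · exact Or.inr h
    · exact Or.inl ⟨_, rfl⟩
  · rintro p (⟨j, rfl⟩ | ⟨j, hj, rfl⟩)
    · exact hT.2 _ _ _
    · rw [Equiv.trans_apply]
      refine notMem_closedBall_of_dist_le (fun e => ?_) (hmin _ ?_)
      · have := π.injective (hP e)
        rw [Equiv.swap_apply_eq_iff, Equiv.swap_apply_left] at this
        exact hj.ne this
      · rw [Finset.mem_Iic, Equiv.swap_apply_def]
        split_ifs
        · exact le_rfl
        · exact hl
        · exact hj.le

end Delaunay

end

theorem mainTheorem3 (n k : ℕ) [NeZero k] (hk : 2 ≤ k) :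
    (∀ {K : Type*} [LinearOrder K] (key : Fin n → K), Function.Injective key →
      ENNReal.ofReal (1 / 8 * Real.log n) ≤
        MultiQueue.expectedExtraSteps n k (BSTSort.dep key)) ∧
    (∀ (P : Fin n → Delaunay.Plane) (T : Affine.Triangle ℝ Delaunay.Plane),
      Function.Injective P → Delaunay.IsBounding P T →
      Delaunay.NoFourConcyclic (Set.range P ∪ Set.range T.points) →
      ENNReal.ofReal (1 / 8 * Real.log n) ≤
        MultiQueue.expectedExtraSteps n k (Delaunay.dep P T)) := by
  cases n with
  -- Here `Real.log 0 = 0`, so the bound is trivial.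
  | zero => simp
  | succ m =>
    exact ⟨fun key hkey => MultiQueue.log_le_expectedExtraSteps hk _
        (BSTSort.exists_swap_dep key hkey),
      fun P T hP hT hV => MultiQueue.log_le_expectedExtraSteps hk _
        (Delaunay.exists_swap_dep P T hP hT hV)⟩
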